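/- **Setting.** Let $\mathbf z=(\mathbf z_1,\dots,\mathbf z_J)$ be random latent variables, $\mathbf z_j$ with values in $\mathbb R^{n_j}$, and let $\mathcal A_1,\dots,\mathcal A_M\subseteq\{1,\dots,J\}$; write $\mathbf z_C=(\mathbf z_j)_{j\in C}$. The process $Gen(\mathbf z,\epsilon,g_1,\dots,g_J,f_1,\dots,f_M)$ consists of a directed acyclic graph on $\{1,\dots,J\}$ with $$\mathbf z_j=g_j(\mathrm{Pa}(\mathbf z_j),\epsilon_j)\ (1\le j\le J),\qquad \mathsf x^{(m)}=f_m(\mathbf z_{\mathcal A_m})\in\mathbb R^{d_m}\ (1\le m\le M)$$ almost surely, where the noise variables $\epsilon_1,\dots,\epsilon_J$ are mutually independent, the $g_j$ are measurable, and the mixing functions $f_m:\prod_{j\in\mathcal A_m}\mathbb R^{n_j}\to\mathbb R^{d_m}$ are smooth and injective (not necessarily surjective). For a non-empty set $S$ of modalities, let $C_S$ be the set of indices $j$ that lie in $\mathcal A_m$ for every $m\in S$ and in at least two of the sets $\mathcal A_1,\dots,\mathcal A_M$; the shared variables of $S$ are $\mathbf c^{(S)}=\mathbf z_{C_S}$.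 So $C_S=\bigcap_{m\in S}\mathcal A_m$ if $|S|\ge2$, and $\mathbf c^{(m)}$ consists of the variables that modality $m$ shares with some other modality. The specific variables $\mathbf s^{(m)}$ of modality $m$ are the remaining variables of $\mathbf z_{\mathcal A_m}$. Let $Sh(m)=\{l:\mathcal A_l\cap\mathcal A_m\ne\emptyset\}$. **Theorem (block-wise identifiability of shared variables).** Suppose that the same observed random vectors $\mathsf x^{(1)},\dots,\mathsf x^{(M)}$ are generated by a true process $Gen(\mathbf z,\epsilon,g_1,\dots,g_J,f_1,\dots,f_M)$ and by an estimated process $Gen(\hat{\mathbf z},\hat\epsilon,\hat g_1,\dots,\hat g_J,\hat f_1,\dots,\hat f_M)$ (on the same probability space, with the same sets $\mathcal A_m$ and dimensions $n_j$, but possibly different causal graphs). Suppose that the true latent vector $\mathbf z$ is continuous, i.e. its law has a density with respect to Lebesgue measure, and that for each $m$ the support of the law of $\mathbf z_{\mathcal A_m}$ is the whole space $\prod_{j\in\mathcal A_m}\mathbb R^{n_j}$. Assume, for all $m$: * **A1 (linear independence).** The Jacobians of $f_m$ and $\hat f_m$ have full column rank at every point. * **A2 (properness).** For $f_m$ and for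 $\hat f_m$: the argument tends to infinity in norm if and only if the value does. * **A3 (conditional and marginal independence, for the true process).** Every causal edge that starts at a specific variable of a modality ends at a specific variable of the same modality; in particular, between shared and specific variables, edges go only from shared to specific ones. Moreover, for all modalities $m\neq k$ with $k\in Sh(m)$, let $\mathbf r^{(m)}$ collect all variables of the $\mathbf c^{(l)}$ with $Sh(m)\cap Sh(l)=\emptyset$. Then each variable of $\mathbf s^{(m)}$ is conditionally independent of each variable of $\mathbf s^{(k)}$ given $(\mathbf c^{(\{m,k\})},\mathbf r^{(m)})$; and each variable of $\mathbf c^{(m)}$ outside $\mathbf c^{(\{m,k\})}$ and each variable of $\mathbf c^{(k)}$ outside $\mathbf c^{(\{m,k\})}$ are either independent or conditionally independent given $\mathbf r^{(m)}$. Then for every non-empty set $S$ of modalities the shared variables of $S$ are block-identified: there is a smooth bijection $h_S$ of $\prod_{j\in C_S}\mathbb R^{n_j}$ onto itself with smooth inverse such that $\hat{\mathbf z}_{C_S}=h_S(\mathbf z_{C_S})$ almost surely. -/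

import Mathlib

open MeasureTheory ProbabilityTheory Filter

namespace MultimodalCRL

/-- The space `∏_{j ∈ S} ℝ^{n j}` of joint values of the latent variables with index in `S`,
where the `j`-th latent variable has dimension `n j`. -/
abbrev Latent {J : ℕ} (n : Fin J → ℕ) (S : Finset (Fin J)) : Type :=
  (j : S) → EuclideanSpace ℝ (Fin (n j))

/-- Indices of the variables that are common to all modalities in `S`, and that are shared, that is,
enter at least two modalities.  For two or more modalities this is just `⋂ m ∈ S, A m`;
for `S = {m}` it is the set of the variables that modality `m` shares with some other modality. -/
def commonIdx {J M : ℕ} (A : Fin M → Finset (Fin J)) (S : Finset (Fin M)) : Finset (Fin J) :=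
  Finset.univ.filter fun j =>
    (∀ m ∈ S, j ∈ A m) ∧ ∃ m k : Fin M, m ≠ k ∧ j ∈ A m ∧ j ∈ A k

/-- Indices of the variables that are specific to modality `m`. -/
def specificIdx {J M : ℕ} (A : Fin M → Finset (Fin J)) (m : Fin M) : Finset (Fin J) :=
  A m \ commonIdx A {m}

/-- `Sh(m)`: the modalities that share some variable with modality `m`. -/
def sh {J M : ℕ} (A : Fin M → Finset (Fin J)) (m : Fin M) : Finset (Fin M) :=
  Finset.univ.filter fun l => (A l ∩ A m).Nonempty

/-- Indices of the shared variables of all the modalities `k` with `Sh(m) ∩ Sh(k) = ∅`. -/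
def remoteIdx {J M : ℕ} (A : Fin M → Finset (Fin J)) (m : Fin M) : Finset (Fin J) :=
  Finset.univ.filter fun j => ∃ k : Fin M, Disjoint (sh A m) (sh A k) ∧ j ∈ commonIdx A {k}

/-- The process in which the latent vector `z` follows the structural causal model with parent sets
`pa`, mechanisms `g` and mutually independent exogenous noise `ε`, and in which modality `m` is
observed as `x m = f m (z_{A m})`, the mixing functions `f m` being smooth and injective. -/
structure Gen {Ω : Type*} [MeasurableSpace Ω] {J M : ℕ} {n : Fin J → ℕ} {d : Fin M → ℕ}
    {E : Fin J → Type*} [∀ j, MeasurableSpace (E j)]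
    (μ : Measure Ω) (A : Fin M → Finset (Fin J))
    (x : (m : Fin M) → Ω → EuclideanSpace ℝ (Fin (d m)))
    (pa : Fin J → Finset (Fin J))
    (z : Ω → (j : Fin J) → EuclideanSpace ℝ (Fin (n j)))
    (ε : (j : Fin J) → Ω → E j)
    (g : (j : Fin J) → Latent n (pa j) → E j → EuclideanSpace ℝ (Fin (n j)))
    (f : (m : Fin M) → Latent n (A m) → EuclideanSpace ℝ (Fin (d m))) : Prop where
  /-- the causal graph is a directed acyclic graph -/
  acyclic : ∀ j, ¬ Relation.TransGen (fun i k => i ∈ pa k) j j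
  measurable_latent : Measurable z
  measurable_noise : ∀ j, Measurable (ε j)
  measurable_mechanism : ∀ j, Measurable (Function.uncurry (g j))
  indep_noise : iIndepFun ε μ
  latent_eq : ∀ j, ∀ᵐ ω ∂μ, z ω j = g j ((pa j).restrict (z ω)) (ε j ω)
  observed_eq : ∀ m, ∀ᵐ ω ∂μ, x m ω = f m ((A m).restrict (z ω))
  smooth_mixing : ∀ m, ContDiff ℝ (⊤ : ℕ∞) (f m)
  injective_mixing : ∀ m, Function.Injective (f m)

/-- The Jacobian of `f` has full column rank at every point. -/
def FullColumnRank {V W : Type*} [NormedAddCommGroup V] [NormedSpace ℝ V]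
    [NormedAddCommGroup W] [NormedSpace ℝ W] (f : V → W) : Prop :=
  ∀ v, Function.Injective (fderiv ℝ f v)

/-- Properness: `‖v‖ → ∞` if and only if `‖f v‖ → ∞`. -/
def IsProperMixing {V W : Type*} [NormedAddCommGroup V] [NormedAddCommGroup W]
    (f : V → W) : Prop :=
  ∀ v : ℕ → V,
    Tendsto (fun k => ‖v k‖) atTop atTop ↔ Tendsto (fun k => ‖f (v k)‖) atTop atTop

/-- The latent variables `z_i` and `z_j` are conditionally independent given `(z_c)_{c ∈ C}`
(expressed by the coordinates of the latent space under the law of `z`). -/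
def CondIndepGiven {Ω : Type*} [MeasurableSpace Ω] {J : ℕ} {n : Fin J → ℕ}
    (μ : Measure Ω) [IsFiniteMeasure μ]
    (z : Ω → (j : Fin J) → EuclideanSpace ℝ (Fin (n j)))
    (C : Finset (Fin J)) (i j : Fin J) : Prop :=
  CondIndepFun
    (MeasurableSpace.comap
      (C.restrict : ((j : Fin J) → EuclideanSpace ℝ (Fin (n j))) → Latent n C) inferInstance)
    (Finset.measurable_restrict C).comap_le
    (fun w => w i) (fun w => w j) (μ.map z)

/-- The condition on causal edges and on conditional and marginal independence between the
latent variables of different modalities. -/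
structure CausalIndependence {Ω : Type*} [MeasurableSpace Ω] {J M : ℕ} {n : Fin J → ℕ}
    (μ : Measure Ω) [IsFiniteMeasure μ] (A : Fin M → Finset (Fin J))
    (pa : Fin J → Finset (Fin J))
    (z : Ω → (j : Fin J) → EuclideanSpace ℝ (Fin (n j))) : Prop where
  /-- A specific variable only has causal influence on specific variables of its own modality;
  in particular there is no edge from a specific variable to a shared one. -/
  edges : ∀ m, ∀ i ∈ specificIdx A m, ∀ j, i ∈ pa j → j ∈ specificIdx A m
  /-- Specific variables of different modalities are conditionally independent. -/
  specific : ∀ m, ∀ k ∈ sh A m, k ≠ m → ∀ i ∈ specificIdx A m, ∀ j ∈ specificIdx A k,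
    CondIndepGiven μ z (commonIdx A {m, k} ∪ remoteIdx A m) i j
  /-- Shared variables of two modalities that are not common to these two are marginally or
  conditionally independent. -/
  shared : ∀ m, ∀ k ∈ sh A m, k ≠ m →
    ∀ i ∈ commonIdx A {m} \ commonIdx A {m, k}, ∀ j ∈ commonIdx A {k} \ commonIdx A {m, k},
      IndepFun (fun ω => z ω i) (fun ω => z ω j) μ ∨ CondIndepGiven μ z (remoteIdx A m) i j

/-- The block of latent variables with index in `C` is block-identified: the estimated block is
the image of the true block under a smooth map with smooth inverse. -/
def BlockIdentified {Ω : Type*} [MeasurableSpace Ω] {J : ℕ} {n : Fin J → ℕ} (μ : Measure Ω)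
    (z z' : Ω → (j : Fin J) → EuclideanSpace ℝ (Fin (n j))) (C : Finset (Fin J)) : Prop :=
  ∃ h : Latent n C ≃ Latent n C, ContDiff ℝ (⊤ : ℕ∞) h ∧ ContDiff ℝ (⊤ : ℕ∞) h.symm ∧
    ∀ᵐ ω ∂μ, C.restrict (z' ω) = h (C.restrict (z ω))

end MultimodalCRL

open MultimodalCRL

/-! Full support and properness put the range of `f m` inside that of `f' m`, so `h m`, the inverse
of `f' m` composed with `f m`, is a smooth proper injective immersion of the block `A m` into itself
carrying true to estimated latents (`exists_transition`). If `j` lies in `A m ∩ A k` and `i` in `A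
m` but not in `A k`, component `j` of `h m` equals a.s. a function not involving `z i`. A smooth
function has zero derivative at almost every one of its zeros, so the density of `z` kills the
`i`-derivative a.s., and full support kills it everywhere (`fderiv_single_eq_zero`). Hence the
common components of `h m` depend on common variables only, and a topological argument shows that
the induced map of the common block is a diffeomorphism (`exists_diffeo_of_triangular`). -/

namespace MultimodalCRL

/-! ### Proper immersions in finite dimension. -/

section Calculus

/-- A map constant in the directions of the kernel of a linear map `π` factors through `π`. -/
theorem eq_of_fderiv_vanishes_on_ker {U V W : Type*} [NormedAddCommGroup U]
    [NormedSpace ℝ U] [NormedAddCommGroup V] [NormedSpace ℝ V] [NormedAddCommGroup W]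
    [NormedSpace ℝ W] (π : V →L[ℝ] U) {F : V → W} (hF : ContDiff ℝ (⊤ : ℕ∞) F)
    (hker : ∀ v u, π u = 0 → fderiv ℝ F v u = 0) {v w : V} (hvw : π v = π w) : F v = F w := by
  have hd : ∀ t : ℝ, HasDerivAt (fun t : ℝ => F (v + t • (w - v))) 0 t := by
    intro t
    have h1 : HasDerivAt (fun t : ℝ => v + t • (w - v)) (w - v) t := by
      simpa using ((hasDerivAt_id t).smul_const (w - v)).const_add v
    have h2 := (hF.differentiable (by simp) (v + t • (w - v))).hasFDerivAt.comp_hasDerivAt t h1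
    rwa [hker _ _ (by simp [hvw])] at h2
  have := is_const_of_deriv_eq_zero (fun t => (hd t).differentiableAt) (fun t => (hd t).deriv) 0 1
  simpa using this

variable {U V W : Type*} [NormedAddCommGroup U] [NormedSpace ℝ U] [FiniteDimensional ℝ U]
  [NormedAddCommGroup V] [NormedSpace ℝ V] [FiniteDimensional ℝ V]
  [NormedAddCommGroup W] [NormedSpace ℝ W] [FiniteDimensional ℝ W]

/-- An injective endomorphism of a finite-dimensional space, as a continuous linear equivalence. -/
noncomputable def equivOfInjective (T : V →L[ℝ] V) (hT : Function.Injective T) : V ≃L[ℝ] V :=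
  (LinearEquiv.ofInjectiveEndo (T : V →ₗ[ℝ] V) hT).toContinuousLinearEquiv

theorem coe_equivOfInjective (T : V →L[ℝ] V) (hT : Function.Injective T) :
    (equivOfInjective T hT : V →L[ℝ] V) = T := by
  ext v
  simp [equivOfInjective]

/-- The norm of the value tends to infinity along every sequence whose norm does. -/
def NormProper {X Y : Type*} [Norm X] [Norm Y] (f : X → Y) : Prop :=
  ∀ v : ℕ → X, Tendsto (fun k => ‖v k‖) atTop atTop → Tendsto (fun k => ‖f (v k)‖) atTop atTop

theorem NormProper.isProperMap {f : V → W} (hp : NormProper f) (hc : Continuous f) :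
    IsProperMap f := by
  have : ProperSpace V := FiniteDimensional.proper_real V
  have : ProperSpace W := FiniteDimensional.proper_real W
  rw [isProperMap_iff_tendsto_cocompact]
  refine ⟨hc, ?_⟩
  rw [← Metric.cobounded_eq_cocompact, ← Metric.cobounded_eq_cocompact,
    ← tendsto_norm_atTop_iff_cobounded, ← comap_norm_atTop]
  refine tendsto_of_seq_tendsto fun v hv => hp v ?_
  exact tendsto_comap_iff.1 hv

theorem isOpenMap_of_injective_fderiv {f : V → V} (hf : ContDiff ℝ (⊤ : ℕ∞) f)
    (hrank : FullColumnRank f) : IsOpenMap f := by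
  have : CompleteSpace V := FiniteDimensional.complete ℝ V
  refine isOpenMap_of_hasStrictFDerivAt_equiv
    (f' := fun v => equivOfInjective (fderiv ℝ f v) (hrank v)) fun v => ?_
  rw [coe_equivOfInjective]
  exact hf.contDiffAt.hasStrictFDerivAt (by simp)

/-- A proper local diffeomorphism of a finite-dimensional space to itself is surjective. -/
theorem surjective_of_normProper {f : V → V} (hf : ContDiff ℝ (⊤ : ℕ∞) f)
    (hrank : FullColumnRank f) (hp : NormProper f) : Function.Surjective f := by
  have hopen := isOpenMap_of_injective_fderiv hf hrank
  have hclosed := (hp.isProperMap hf.continuous).isClosedMap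
  -- `V` is connected, so a nonempty clopen range is everything.
  have : IsClopen (Set.range f) := ⟨hclosed.isClosed_range, hopen.isOpen_range⟩
  exact Set.range_eq_univ.1 (this.eq_univ (Set.range_nonempty f))

theorem contDiff_symm_of_bijective {f : V → V} (hf : ContDiff ℝ (⊤ : ℕ∞) f)
    (hrank : FullColumnRank f) (hb : Function.Bijective f) :
    ContDiff ℝ (⊤ : ℕ∞) (Equiv.ofBijective f hb).symm := by
  have : CompleteSpace V := FiniteDimensional.complete ℝ V
  let e := (Equiv.ofBijective f hb).toHomeomorphOfContinuousOpen hf.continuous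
    (isOpenMap_of_injective_fderiv hf hrank)
  refine Homeomorph.contDiff_symm e
    (f₀' := fun v => equivOfInjective (fderiv ℝ f v) (hrank v)) (fun v => ?_) hf
  rw [coe_equivOfInjective]
  exact (hf.differentiable (by simp) v).hasFDerivAt

/-- If the range of `f` lies in the range of a smooth proper injective immersion `f'`, then `f`
factors smoothly through `f'`. -/
theorem exists_contDiff_factor {f f' : V → W} (hf : ContDiff ℝ (⊤ : ℕ∞) f)
    (hf' : ContDiff ℝ (⊤ : ℕ∞) f') (hinj' : Function.Injective f') (hrank' : FullColumnRank f')
    (hp' : NormProper f') (hrange : ∀ v, f v ∈ Set.range f') :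
    ∃ h : V → V, ContDiff ℝ (⊤ : ℕ∞) h ∧ ∀ v, f' (h v) = f v := by
  have : CompleteSpace V := FiniteDimensional.complete ℝ V
  choose h hh using hrange
  refine ⟨h, ?_, hh⟩
  have hemb : Topology.IsClosedEmbedding f' :=
    .of_continuous_injective_isClosedMap hf'.continuous hinj'
      (hp'.isProperMap hf'.continuous).isClosedMap
  have hc : Continuous h := by
    rw [hemb.isInducing.continuous_iff]
    convert hf.continuous using 1
    exact funext hh
  rw [contDiff_iff_contDiffAt]
  intro v
  -- With `L` a left inverse of the derivative of `f'` at `h v`, the map `L ∘ f'` is locally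
  -- invertible there. As `h` is continuous, near `v` it equals this local inverse applied to `L ∘
  -- f`.
  obtain ⟨T, hT⟩ := LinearMap.exists_leftInverse_of_injective
    (fderiv ℝ f' (h v) : V →ₗ[ℝ] W) (LinearMap.ker_eq_bot.2 (hrank' (h v)))
  let L : W →L[ℝ] V := LinearMap.toContinuousLinearMap T
  have hG : ContDiff ℝ (⊤ : ℕ∞) (fun w => L (f' w)) := L.contDiff.comp hf'
  have hG' : HasFDerivAt (fun w => L (f' w))
      ((ContinuousLinearEquiv.refl ℝ V : V ≃L[ℝ] V) : V →L[ℝ] V) (h v) := by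
    have h1 : HasFDerivAt (fun w => L (f' w)) (L.comp (fderiv ℝ f' (h v))) (h v) :=
      L.hasFDerivAt.comp (h v) (hf'.differentiable (by simp) (h v)).hasFDerivAt
    have h2 : L.comp (fderiv ℝ f' (h v)) = ContinuousLinearMap.id ℝ V :=
      ContinuousLinearMap.ext fun u => LinearMap.congr_fun hT u
    rwa [h2] at h1
  have hloc := (hG.contDiffAt (x := h v)).to_localInverse hG' (by simp)
  have hev := (hG.contDiffAt.hasStrictFDerivAt' hG' (by simp)).eventually_left_inverse
  have hcomp : ContDiffAt ℝ (⊤ : ℕ∞)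
      (fun u => (hG.contDiffAt (x := h v)).localInverse hG' (by simp) (L (f u))) v := by
    refine ContDiffAt.comp v ?_ (L.contDiff.comp hf).contDiffAt
    rw [← hh v]
    exact hloc
  refine hcomp.congr_of_eventuallyEq ?_
  filter_upwards [hc.continuousAt.eventually hev] with u hu
  rw [← hh u]
  exact hu.symm

/-- A proper injective immersion of a finite-dimensional space to itself that is triangular with
respect to a split surjection `π` descends to a diffeomorphism of the target of `π`. -/
theorem exists_diffeo_of_triangular (π : V →L[ℝ] U) (σ : U →L[ℝ] V) (hπσ : ∀ u, π (σ u) = u)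
    {h : V → V} (hh : ContDiff ℝ (⊤ : ℕ∞) h) (hinj : Function.Injective h)
    (hrank : FullColumnRank h) (hp : NormProper h)
    (hker : ∀ v u, π u = 0 → π (fderiv ℝ h v u) = 0) :
    ∃ H : U ≃ U, ContDiff ℝ (⊤ : ℕ∞) H ∧ ContDiff ℝ (⊤ : ℕ∞) H.symm ∧
      ∀ v, π (h v) = H (π v) := by
  have hdh := hh.differentiable (by simp)
  have hsurj := surjective_of_normProper hh hrank hp
  let H : U → U := fun u => π (h (σ u))
  have hH : ContDiff ℝ (⊤ : ℕ∞) H := π.contDiff.comp (hh.comp σ.contDiff)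
  have hfac : ∀ v, π (h v) = H (π v) := by
    intro v
    refine eq_of_fderiv_vanishes_on_ker (F := fun v => π (h v)) π (π.contDiff.comp hh) ?_
      (hπσ (π v)).symm
    intro v u hu
    have := (π.hasFDerivAt.comp v (hdh v).hasFDerivAt).fderiv
    change fderiv ℝ (π ∘ h) v u = 0
    rw [this]
    exact hker v u hu
  have hHsurj : Function.Surjective H := by
    intro u
    obtain ⟨v, hv⟩ := hsurj (σ u)
    exact ⟨π v, by rw [← hfac, hv, hπσ]⟩
  have hHrank : FullColumnRank H := by
    intro u
    have hd : fderiv ℝ H u = π.comp ((fderiv ℝ h (σ u)).comp σ) :=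
      (π.hasFDerivAt.comp u ((hdh (σ u)).hasFDerivAt.comp u σ.hasFDerivAt)).fderiv
    -- Solve `dh x = σ y`; then `x` and `σ (π x)` differ by an element of `ker π`, which `dh`
    -- preserves.
    have hs : Function.Surjective (fderiv ℝ H u : U →ₗ[ℝ] U) := by
      intro y
      obtain ⟨x, hx⟩ := (equivOfInjective _ (hrank (σ u))).surjective (σ y)
      rw [← ContinuousLinearEquiv.coe_coe, coe_equivOfInjective] at hx
      refine ⟨π x, ?_⟩
      have h0 := hker (σ u) (x - σ (π x)) (by simp [hπσ])
      rw [map_sub, map_sub, sub_eq_zero, hx, hπσ] at h0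
      rw [ContinuousLinearMap.coe_coe, hd]
      exact h0.symm
    exact LinearMap.injective_iff_surjective.2 hs
  have hHinj : Function.Injective H := by
    -- `h` sends the fibre of `π` over `c` into the fibre over `H c`. Read in `ker π`, this is a
    -- proper local diffeomorphism `k`, hence onto, so the fibre over `c` reaches the base point `σ
    -- (H c)`. If `H c = H c'`, both fibres reach the same point, and injectivity of `h` gives `c =
    -- c'`.
    have hzero : ∀ c : U, ∃ s : V, π s = c ∧ h s = σ (H c) := by
      intro c
      let K := LinearMap.ker (π : V →ₗ[ℝ] U)
      let P : V →L[ℝ] K := (ContinuousLinearMap.id ℝ V - σ.comp π).codRestrict K (by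
        intro v
        simp [K, hπσ])
      have hP : ∀ v, (P v : V) = v - σ (π v) := fun v => rfl
      let k : K → K := fun s => P (h (σ c + s))
      have hshift : ContDiff ℝ (⊤ : ℕ∞) (fun s : K => σ c + (s : V)) :=
        contDiff_const.add K.subtypeL.contDiff
      have hk : ContDiff ℝ (⊤ : ℕ∞) k := P.contDiff.comp (hh.comp hshift)
      have hkval : ∀ s : K, h (σ c + s) = σ (H c) + k s := by
        intro s
        have hs : π (s : V) = 0 := s.2
        have : π (σ c + s) = c := by rw [map_add, hπσ, hs, add_zero]
        change _ = _ + (P _ : V)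
        rw [hP, hfac, this]
        abel
      have hkrank : FullColumnRank k := by
        intro s
        have hd : fderiv ℝ k s = P.comp ((fderiv ℝ h (σ c + s)).comp K.subtypeL) :=
          (P.hasFDerivAt.comp s ((hdh (σ c + s)).hasFDerivAt.comp s
            (K.subtypeL.hasFDerivAt.const_add (σ c)))).fderiv
        rw [injective_iff_map_eq_zero]
        intro t ht
        rw [hd] at ht
        have ht' : (P (fderiv ℝ h (σ c + s) t) : V) = 0 := by
          exact congrArg Subtype.val ht
        rw [hP, hker _ _ t.2, map_zero, sub_zero] at ht'
        exact Subtype.ext ((injective_iff_map_eq_zero _).1 (hrank _) _ ht')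
      have hkp : NormProper k := by
        intro s hs
        have h1 : Tendsto (fun i => ‖σ c + (s i : V)‖) atTop atTop := by
          refine tendsto_atTop_mono (fun i => ?_) (tendsto_atTop_add_const_right _ (-‖σ c‖) hs)
          have := norm_sub_le (σ c + (s i : V)) (σ c)
          rw [add_sub_cancel_left] at this
          change ‖(s i : V)‖ + _ ≤ _
          linarith
        refine tendsto_atTop_mono (fun i => ?_)
          (tendsto_atTop_add_const_right _ (-‖σ (H c)‖) (hp _ h1))
        rw [hkval]
        have := norm_add_le (σ (H c)) (k (s i) : V)
        change _ ≤ ‖(k (s i) : V)‖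
        linarith
      obtain ⟨s, hs⟩ := surjective_of_normProper hk hkrank hkp 0
      refine ⟨σ c + s, ?_, ?_⟩
      · have : π (s : V) = 0 := s.2
        rw [map_add, hπσ, this, add_zero]
      · rw [hkval, hs]
        simp
    intro c c' hcc
    obtain ⟨s, hs, hs'⟩ := hzero c
    obtain ⟨t, ht, ht'⟩ := hzero c'
    rw [← hs, ← ht, hinj (hs'.trans ((congrArg σ hcc).trans ht'.symm))]
  exact ⟨Equiv.ofBijective H ⟨hHinj, hHsurj⟩, hH,
    contDiff_symm_of_bijective hH hHrank ⟨hHinj, hHsurj⟩, hfac⟩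

/-- The derivative of a smooth function vanishes at almost every zero of the function. -/
theorem ae_fderiv_eq_zero_of_eq_zero [MeasurableSpace V] [BorelSpace V] (ν : Measure V)
    [ν.IsAddHaarMeasure] {F : V → V} (hF : ContDiff ℝ (⊤ : ℕ∞) F) :
    ∀ᵐ v ∂ν, F v = 0 → fderiv ℝ F v = 0 := by
  have hs : MeasurableSet {v | F v = 0} :=
    (isClosed_singleton.preimage hF.continuous : IsClosed (F ⁻¹' {0})).measurableSet
  -- On its zero set `F` agrees with the zero map, with error constant 0; at density points of that
  -- set this bounds the derivative by 0.
  have happ : ApproximatesLinearOn F (0 : V →L[ℝ] V) {v | F v = 0} 0 := by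
    intro v hv w hw
    rw [Set.mem_ofPred_eq] at hv hw
    simp [hv, hw]
  have := happ.norm_fderiv_sub_le ν hs (fderiv ℝ F) fun v _ =>
    (hF.differentiable (by simp) v).hasFDerivAt.hasFDerivWithinAt
  rw [ae_restrict_iff' hs] at this
  filter_upwards [this] with v hv hv0
  simpa using hv hv0

end Calculus

/-! ### From almost sure identities to transition maps. -/

theorem IsProperMixing.normProper {V W : Type*} [NormedAddCommGroup V] [NormedAddCommGroup W]
    {f : V → W} (hf : IsProperMixing f) : NormProper f :=
  fun v hv => (hf v).1 hv

/-- A closed set that contains a random element almost surely is everything if the law of the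
random element has full support. -/
theorem mem_of_ae_mem_isClosed {Ω X : Type*} [MeasurableSpace Ω] {μ : Measure Ω}
    [TopologicalSpace X] [MeasurableSpace X] [OpensMeasurableSpace X] {Y : Ω → X}
    (hY : Measurable Y) (hsupp : (μ.map Y).IsOpenPosMeasure) {P : Set X} (hP : IsClosed P)
    (hae : ∀ᵐ ω ∂μ, Y ω ∈ P) (x : X) : x ∈ P := by
  have h : ∀ᵐ y ∂μ.map Y, y ∈ P := (ae_map_iff hY.aemeasurable hP.measurableSet).2 hae
  rw [hP.ae_eq_univ_iff_eq.1 (eventuallyEq_univ.2 h)]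
  trivial

section Transition

variable {V W : Type*} [NormedAddCommGroup V] [NormedSpace ℝ V] [FiniteDimensional ℝ V]
  [NormedAddCommGroup W] [NormedSpace ℝ W] [FiniteDimensional ℝ W]

/-- The change of coordinates between two parametrizations of the same observation. -/
theorem exists_transition {Ω : Type*} [MeasurableSpace Ω] {μ : Measure Ω}
    [MeasurableSpace V] [BorelSpace V] {Y Y' : Ω → V} (hY : Measurable Y)
    (hsupp : (μ.map Y).IsOpenPosMeasure) {f f' : V → W} (hf : ContDiff ℝ (⊤ : ℕ∞) f)
    (hf' : ContDiff ℝ (⊤ : ℕ∞) f') (hinj : Function.Injective f) (hinj' : Function.Injective f')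
    (hrank : FullColumnRank f) (hrank' : FullColumnRank f') (hp : IsProperMixing f)
    (hp' : IsProperMixing f') (heq : ∀ᵐ ω ∂μ, f (Y ω) = f' (Y' ω)) :
    ∃ h : V → V, ContDiff ℝ (⊤ : ℕ∞) h ∧ Function.Injective h ∧ FullColumnRank h ∧ NormProper h ∧
      ∀ᵐ ω ∂μ, Y' ω = h (Y ω) := by
  have hclosed : IsClosed (f ⁻¹' Set.range f') :=
    (hp'.normProper.isProperMap hf'.continuous).isClosedMap.isClosed_range.preimage hf.continuous
  have hrange := mem_of_ae_mem_isClosed hY hsupp hclosed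
    (heq.mono fun ω hω => ⟨Y' ω, hω.symm⟩)
  obtain ⟨h, hh, hfac⟩ := exists_contDiff_factor hf hf' hinj' hrank' hp'.normProper hrange
  have hcomp : f' ∘ h = f := funext hfac
  refine ⟨h, hh, ?_, ?_, ?_, ?_⟩
  · rw [← hcomp] at hinj
    exact hinj.of_comp
  · intro v
    have hd : fderiv ℝ f v = (fderiv ℝ f' (h v)).comp (fderiv ℝ h v) := by
      rw [← hcomp]
      exact fderiv_comp v (hf'.differentiable (by simp) _) (hh.differentiable (by simp) v)
    have := hrank v
    rw [hd, ContinuousLinearMap.coe_comp] at this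
    exact this.of_comp
  · intro v hv
    -- The converse half of properness of `f'`: large values force large arguments.
    rw [hp' fun k => h (v k)]
    simp only [hfac]
    exact (hp v).1 hv
  · filter_upwards [heq] with ω hω
    exact hinj' (by rw [hfac, hω])

end Transition

/-! ### Coordinate blocks as linear maps. -/

section Restriction

variable {J : ℕ} (n : Fin J → ℕ)

/-- Restriction of a joint value of all latent variables to a block, as a linear map. -/
noncomputable def restrictL (S : Finset (Fin J)) :
    ((j : Fin J) → EuclideanSpace ℝ (Fin (n j))) →L[ℝ] Latent n S :=
  ContinuousLinearMap.pi fun j : S => ContinuousLinearMap.proj (j : Fin J)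

theorem restrictL_apply (S : Finset (Fin J)) (z : (j : Fin J) → EuclideanSpace ℝ (Fin (n j))) :
    restrictL n S z = S.restrict z := rfl

/-- Restriction of a block of latent variables to a smaller block, as a linear map. -/
noncomputable def subrestrictL {C S : Finset (Fin J)} (h : C ⊆ S) : Latent n S →L[ℝ] Latent n C :=
  ContinuousLinearMap.pi fun j : C => ContinuousLinearMap.proj (⟨j, h j.2⟩ : S)

theorem subrestrictL_apply {C S : Finset (Fin J)} (h : C ⊆ S) (v : Latent n S) (j : C) :
    subrestrictL n h v j = v ⟨j, h j.2⟩ := rfl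

theorem subrestrictL_restrict {C S : Finset (Fin J)} (h : C ⊆ S)
    (z : (j : Fin J) → EuclideanSpace ℝ (Fin (n j))) :
    subrestrictL n h (S.restrict z) = C.restrict z := rfl

/-- Extension of a block of latent variables by zero. -/
noncomputable def extendL (C S : Finset (Fin J)) : Latent n C →L[ℝ] Latent n S :=
  ContinuousLinearMap.pi fun j : S =>
    if hj : (j : Fin J) ∈ C then ContinuousLinearMap.proj (⟨j, hj⟩ : C) else 0

theorem subrestrictL_extendL {C S : Finset (Fin J)} (h : C ⊆ S) (u : Latent n C) :
    subrestrictL n h (extendL n C S u) = u := by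
  funext j
  simp [subrestrictL_apply, extendL]

end Restriction

/-! ### Shared components ignore non-shared variables. -/

/-- If component `j` of a smooth function of the block `S` almost surely agrees with component `j`
of a smooth function of the block `T`, and `i` is not in `T`, then the former does not depend on
variable `i`. -/
theorem fderiv_single_eq_zero {Ω : Type*} [MeasurableSpace Ω] {μ : Measure Ω} {J : ℕ}
    {n : Fin J → ℕ} {z : Ω → (j : Fin J) → EuclideanSpace ℝ (Fin (n j))} (hz : Measurable z)
    (hcont : μ.map z ≪ volume) {S T : Finset (Fin J)}
    (hsupp : (μ.map fun ω => S.restrict (z ω)).IsOpenPosMeasure)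
    {h : Latent n S → Latent n S} {k : Latent n T → Latent n T}
    (hh : ContDiff ℝ (⊤ : ℕ∞) h) (hk : ContDiff ℝ (⊤ : ℕ∞) k) {i j : Fin J}
    (hiS : i ∈ S) (hiT : i ∉ T) (hjS : j ∈ S) (hjT : j ∈ T)
    (heq : ∀ᵐ ω ∂μ, h (S.restrict (z ω)) ⟨j, hjS⟩ = k (T.restrict (z ω)) ⟨j, hjT⟩)
    (v : Latent n S) (u : EuclideanSpace ℝ (Fin (n i))) :
    fderiv ℝ h v (Pi.single ⟨i, hiS⟩ u) ⟨j, hjS⟩ = 0 := by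
  -- Embedding the difference of components in the full latent space makes `F` an endomorphism, as
  -- `ae_fderiv_eq_zero_of_eq_zero` requires.
  let ιj := ContinuousLinearMap.single ℝ (fun j : Fin J => EuclideanSpace ℝ (Fin (n j))) j
  let pS : Latent n S →L[ℝ] EuclideanSpace ℝ (Fin (n j)) :=
    ContinuousLinearMap.proj (⟨j, hjS⟩ : S)
  let pT : Latent n T →L[ℝ] EuclideanSpace ℝ (Fin (n j)) :=
    ContinuousLinearMap.proj (⟨j, hjT⟩ : T)
  let F : ((j : Fin J) → EuclideanSpace ℝ (Fin (n j))) →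
      (j : Fin J) → EuclideanSpace ℝ (Fin (n j)) :=
    fun w => ιj (pS (h (restrictL n S w)) - pT (k (restrictL n T w)))
  have hF : ContDiff ℝ (⊤ : ℕ∞) F :=
    ιj.contDiff.comp ((pS.contDiff.comp (hh.comp (restrictL n S).contDiff)).sub
      (pT.contDiff.comp (hk.comp (restrictL n T).contDiff)))
  have hdF : ∀ w, fderiv ℝ F w = ιj.comp
      (pS.comp ((fderiv ℝ h (restrictL n S w)).comp (restrictL n S)) -
        pT.comp ((fderiv ℝ k (restrictL n T w)).comp (restrictL n T))) := by
    intro w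
    have h1 := pS.hasFDerivAt.comp w
      ((hh.differentiable (by simp) (restrictL n S w)).hasFDerivAt.comp w
        (restrictL n S).hasFDerivAt)
    have h2 := pT.hasFDerivAt.comp w
      ((hk.differentiable (by simp) (restrictL n T w)).hasFDerivAt.comp w
        (restrictL n T).hasFDerivAt)
    exact (ιj.hasFDerivAt.comp w (h1.sub h2)).fderiv
  have hae : ∀ᵐ ω ∂μ, F (z ω) = 0 → fderiv ℝ F (z ω) = 0 :=
    ae_of_ae_map hz.aemeasurable (hcont.ae_le (ae_fderiv_eq_zero_of_eq_zero volume hF))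
  have hclosed : IsClosed {v : Latent n S | pS (fderiv ℝ h v (Pi.single ⟨i, hiS⟩ u)) = 0} :=
    isClosed_eq (pS.continuous.comp
      ((hh.continuous_fderiv (by simp)).clm_apply continuous_const)) continuous_const
  refine mem_of_ae_mem_isClosed ((Finset.measurable_restrict S).comp hz) hsupp hclosed ?_ v
  filter_upwards [hae, heq] with ω hω heqω
  have h0 : F (z ω) = 0 := by
    change ιj (h (S.restrict (z ω)) ⟨j, hjS⟩ - k (T.restrict (z ω)) ⟨j, hjT⟩) = 0
    rw [heqω, sub_self, map_zero]
  have h1 := congrArg (fun T => T (Pi.single i u) j) (hω h0)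
  have hS : restrictL n S (Pi.single i u) = Pi.single ⟨i, hiS⟩ u := by
    funext l
    rcases eq_or_ne l ⟨i, hiS⟩ with rfl | hl
    · simp [restrictL_apply]
    · rw [Pi.single_eq_of_ne hl, restrictL_apply, Finset.restrict,
        Pi.single_eq_of_ne fun h => hl (Subtype.ext h)]
  have hT : restrictL n T (Pi.single i u) = 0 := by
    funext l
    rw [restrictL_apply, Finset.restrict, Pi.single_eq_of_ne fun (e : (l : Fin J) = i) => hiT (e ▸ l.2)]
    rfl
  rw [hdF] at h1
  simpa [ιj, hS, hT, restrictL_apply] using h1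

/-- A shared index and an index outside a common block are separated by a modality. -/
theorem exists_modality_separating {J M : ℕ} {A : Fin M → Finset (Fin J)} {S : Finset (Fin M)}
    {i j : Fin J} (hiC : i ∉ commonIdx A S) (hj : j ∈ commonIdx A S) :
    ∃ k, j ∈ A k ∧ i ∉ A k := by
  simp only [commonIdx, Finset.mem_filter, Finset.mem_univ, true_and] at hiC hj
  by_contra! hcon
  obtain ⟨hjS, a, b, hab, hja, hjb⟩ := hj
  -- If every modality containing `j` contained `i`, then `i` would inherit both membership
  -- conditions from `j`.
  exact hiC ⟨fun k hk => hcon k (hjS k hk), a, b, hab, hcon a hja, hcon b hjb⟩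

theorem commonIdx_subset {J M : ℕ} {A : Fin M → Finset (Fin J)} {S : Finset (Fin M)}
    {m : Fin M} (hm : m ∈ S) : commonIdx A S ⊆ A m := by
  intro j hj
  simp only [commonIdx, Finset.mem_filter] at hj
  exact hj.2.1 m hm

end MultimodalCRL

theorem theorem1 {Ω : Type*} [MeasurableSpace Ω] (μ : Measure Ω) [IsProbabilityMeasure μ]
    {J M : ℕ} (n : Fin J → ℕ) (d : Fin M → ℕ) (A : Fin M → Finset (Fin J))
    {E E' : Fin J → Type*} [∀ j, MeasurableSpace (E j)] [∀ j, MeasurableSpace (E' j)]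
    -- the observations
    (x : (m : Fin M) → Ω → EuclideanSpace ℝ (Fin (d m)))
    -- the true process
    (pa : Fin J → Finset (Fin J))
    (z : Ω → (j : Fin J) → EuclideanSpace ℝ (Fin (n j)))
    (ε : (j : Fin J) → Ω → E j)
    (g : (j : Fin J) → Latent n (pa j) → E j → EuclideanSpace ℝ (Fin (n j)))
    (f : (m : Fin M) → Latent n (A m) → EuclideanSpace ℝ (Fin (d m)))
    (hgen : Gen μ A x pa z ε g f)
    -- the estimated process, with the same observations
    (pa' : Fin J → Finset (Fin J))
    (z' : Ω → (j : Fin J) → EuclideanSpace ℝ (Fin (n j)))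
    (ε' : (j : Fin J) → Ω → E' j)
    (g' : (j : Fin J) → Latent n (pa' j) → E' j → EuclideanSpace ℝ (Fin (n j)))
    (f' : (m : Fin M) → Latent n (A m) → EuclideanSpace ℝ (Fin (d m)))
    (hgen' : Gen μ A x pa' z' ε' g' f')
    -- the true latent vector is a continuous random vector, and the latent vector of each
    -- modality ranges over its whole latent space
    (hcont : μ.map z ≪ volume)
    (hsupp : ∀ m, (μ.map fun ω => (A m).restrict (z ω)).IsOpenPosMeasure)
    -- linear independence
    (hrank : ∀ m, FullColumnRank (f m)) (hrank' : ∀ m, FullColumnRank (f' m))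
    -- properness
    (hproper : ∀ m, IsProperMixing (f m)) (hproper' : ∀ m, IsProperMixing (f' m))
    -- causal edges, conditional and marginal independence
    (hind : CausalIndependence μ A pa z) :
    ∀ S : Finset (Fin M), S.Nonempty → BlockIdentified μ z z' (commonIdx A S) := by
  have hz := hgen.measurable_latent
  have htrans := fun m => exists_transition (Y' := fun ω => (A m).restrict (z' ω))
    ((Finset.measurable_restrict (A m)).comp hz) (hsupp m)
    (hgen.smooth_mixing m) (hgen'.smooth_mixing m) (hgen.injective_mixing m)
    (hgen'.injective_mixing m) (hrank m) (hrank' m) (hproper m) (hproper' m) (by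
      filter_upwards [hgen.observed_eq m, hgen'.observed_eq m] with ω h1 h2
      exact h1.symm.trans h2)
  choose h hh hinj hhrank hhp heq using htrans
  rintro S ⟨m, hm⟩
  have hCm := commonIdx_subset (A := A) hm
  obtain ⟨H, hH, hH', hfac⟩ := exists_diffeo_of_triangular (subrestrictL n hCm)
    (extendL n (commonIdx A S) (A m)) (subrestrictL_extendL n hCm) (hh m) (hinj m) (hhrank m)
    (hhp m) (by
      intro v u hu
      funext j
      -- Triangularity is checked one variable at a time: common coordinates of `u` vanish, and the
      -- others do not affect component `j`.
      rw [← Finset.univ_sum_single u, map_sum, map_sum, Finset.sum_apply]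
      refine Finset.sum_eq_zero fun i _ => ?_
      by_cases hi : (i : Fin J) ∈ commonIdx A S
      · have : u i = 0 := congrFun hu ⟨i, hi⟩
        rw [this, Pi.single_zero, map_zero, map_zero]
        rfl
      · obtain ⟨k, hjk, hik⟩ := exists_modality_separating hi j.2
        refine fderiv_single_eq_zero hz hcont (hsupp m) (hh m) (hh k) i.2 hik (hCm j.2) hjk ?_
          v (u i)
        filter_upwards [heq m, heq k] with ω h1 h2
        exact (congrFun h1 ⟨j, hCm j.2⟩).symm.trans (congrFun h2 ⟨j, hjk⟩))
  refine ⟨H, hH, hH', ?_⟩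
  filter_upwards [heq m] with ω hω
  rw [← subrestrictL_restrict n hCm (z ω), ← hfac]
  exact congrArg (subrestrictL n hCm) hω
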